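/- Let $\mathbb{F}_k$ denote the free group with basis $e_1,\dots,e_k$, and regard $\mathbb{F}_n$ as the subgroup of $\mathbb{F}_{n+m}$ generated by $e_1,\dots,e_n$ ($n,m\ge 0$). A formula over $\mathbb{F}_n$ is a first-order formula in the language of groups with parameters from $\mathbb{F}_n$; it is positive if it is built from atomic formulas using only conjunction, disjunction and the quantifiers $\forall,\exists$. Let $\phi(\bar x)$ be a positive formula over $\mathbb{F}_n$ in the free variables $\bar x=(x_1,\dots,x_m)$, and let $\phi(\mathbb{F}_n)\subseteq\mathbb{F}_n^m$ be its solution set in $\mathbb{F}_n$. (1) If $\mathbb{F}_{n+m}\models\phi(e_{n+1},\dots,e_{n+m})$, then $\phi(\mathbb{F}_n)=\mathbb{F}_n^m$. (2) If $n\ge 2$ and $\phi$ is proper, i.e. $\phi(\mathbb{F}_n)\ne\mathbb{F}_n^m$, then $\phi$ is not generic, i.e. no finite number of left translates $g\cdot\phi(\mathbb{F}_n)$, $g\in\mathbb{F}_n^m$, cover the group $\mathbb{F}_n^m$. -/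

import Mathlib

open scoped FirstOrder Pointwise

/-- The function symbols of the language of groups: multiplication, inverse, identity. -/
inductive GroupFunc : ℕ → Type
  | mul : GroupFunc 2
  | inv : GroupFunc 1
  | one : GroupFunc 0

/-- The first-order language of groups (equality is part of the logic). -/
def groupLanguage : FirstOrder.Language :=
  { Functions := GroupFunc
    Relations := fun _ => Empty }

/-- Every group is a structure for the language of groups in the standard way. -/
instance groupStructure (G : Type*) [Group G] : groupLanguage.Structure G where
  funMap := fun {k} f =>
    match k, f with
    | _, .mul => fun x => x 0 * x 1
    | _, .inv => fun x => (x 0)⁻¹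
    | _, .one => fun _ => 1
  RelMap := fun r => Empty.elim r

/-- Positive formulas: those built from atomic formulas (including the constant `⊥`; the constant
`⊤` is covered up to equivalence by an equation `t = t`) by conjunction, disjunction and both
quantifiers, without negation or implication. -/
inductive IsPositive {L : FirstOrder.Language} {α : Type*} :
    ∀ {k : ℕ}, L.BoundedFormula α k → Prop
  | falsum {k : ℕ} : IsPositive (⊥ : L.BoundedFormula α k)
  | equal {k : ℕ} (t₁ t₂ : L.Term (α ⊕ Fin k)) : IsPositive (t₁.bdEqual t₂)
  | rel {k l : ℕ} (R : L.Relations l) (ts : Fin l → L.Term (α ⊕ Fin k)) :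
      IsPositive (R.boundedFormula ts)
  | inf {k : ℕ} {φ ψ : L.BoundedFormula α k} :
      IsPositive φ → IsPositive ψ → IsPositive (φ ⊓ ψ)
  | sup {k : ℕ} {φ ψ : L.BoundedFormula α k} :
      IsPositive φ → IsPositive ψ → IsPositive (φ ⊔ ψ)
  | all {k : ℕ} {φ : L.BoundedFormula α (k + 1)} : IsPositive φ → IsPositive φ.all
  | ex {k : ℕ} {φ : L.BoundedFormula α (k + 1)} : IsPositive φ → IsPositive φ.ex

/-- A first-order formula in the language of groups over `F_n` (that is, with parameters from the
free group of rank `n`), in the free variables `x_1, …, x_m`. -/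
abbrev FormulaOver (n m : ℕ) : Type :=
  (groupLanguage[[FreeGroup (Fin n)]]).Formula (Fin m)

/-- `G ⊨ φ(x)`, for a formula `φ` over `F_n`, where each parameter `p ∈ F_n` is read in the group
`G` as `ι p`. -/
def SatisfiedBy {n m : ℕ} {G : Type*} [Group G] (ι : FreeGroup (Fin n) →* G)
    (φ : FormulaOver n m) (x : Fin m → G) : Prop :=
  letI : (FirstOrder.Language.constantsOn (FreeGroup (Fin n))).Structure G :=
    FirstOrder.Language.constantsOn.structure ι
  φ.Realize x

/-- The standard inclusion of `F_n` in `F_{n+m}`, with `e_i ↦ e_i` for the first `n` basis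
elements. -/
def freeInclusion (n m : ℕ) : FreeGroup (Fin n) →* FreeGroup (Fin (n + m)) :=
  FreeGroup.map (Fin.castAdd m)

/-- The tuple `(e_{n+1}, …, e_{n+m})` of the last `m` basis elements of `F_{n+m}`. -/
def newBasis (n m : ℕ) : Fin m → FreeGroup (Fin (n + m)) :=
  fun i => FreeGroup.of (Fin.natAdd n i)

/-- The solution set `φ(F_n) ⊆ F_n ^ m` of a formula `φ` over `F_n`. -/
def solutionSet {n m : ℕ} (φ : FormulaOver n m) : Set (Fin m → FreeGroup (Fin n)) :=
  {x | SatisfiedBy (MonoidHom.id (FreeGroup (Fin n))) φ x}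

/-- A subset of a group is generic if finitely many of its translates cover the group. -/
def IsGenericSet {G : Type*} [Group G] (X : Set G) : Prop :=
  ∃ S : Finset G, ⋃ g ∈ S, g • X = Set.univ

/-- A formula over `F_n` in `m` free variables is generic if finitely many translates of its
solution set by elements of the group `F_n ^ m` cover this group. -/
def IsGenericFormula {n m : ℕ} (φ : FormulaOver n m) : Prop :=
  IsGenericSet (solutionSet φ)

/-! Part (1): a retraction of `F_{n+m}` onto `F_n` sending the new basis elements to any prescribed
tuple is surjective, and positive formulas survive surjective homomorphisms. For (2), view `F_n` (n
≥ 2) as a free product and replace homomorphisms to `F_{n+m}` by random maps: finite families of odd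
maps on letters, evaluated along reduced words. Each product `g * h` costs at most one letter
multiplication (`OddMap.eval_mul`), so it is respected by most members once each letter
multiplication is. Such a family can be split into N copies so that one new word takes arbitrary
prescribed values, old values being kept (`IsAlmostMul.exists_extension`). Feeding in
counterexamples as those values handles `∀`, so positive truths of `F_n` pass to most members
(`IsPositive.exists_holds_eval`). Now let a family send a tuple `x` to the new basis. If translates
cover, `x` lies in some `g • φ`, and a good member yields `φ(g⁻¹ e)` in `F_{n+m}`. The argument of
(1), with `e ↦ g u`, gives `φ(u)` for every `u`. -/

open Monoid

/-! ### Odd maps and their evaluation on reduced words -/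

/-- A map on the letters of a free product that commutes with inversion on each factor. -/
structure OddMap {ι : Type*} (G : ι → Type*) [∀ i, Group (G i)] (H : Type*) [Group H] where
  /-- The value on a letter. -/
  val : (Σ i, G i) → H
  val_one : ∀ i, val ⟨i, 1⟩ = 1
  val_inv : ∀ i (s : G i), val ⟨i, s⁻¹⟩ = (val ⟨i, s⟩)⁻¹

/-- A list of letters is reduced if it is the list of letters of a reduced word. -/
def IsReducedList {ι : Type*} {G : ι → Type*} [∀ i, Group (G i)] (l : List (Σ i, G i)) : Prop :=
  (∀ p ∈ l, p.2 ≠ 1) ∧ l.IsChain fun p q => p.1 ≠ q.1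

namespace OddMap

variable {ι : Type*} {G : ι → Type*} [∀ i, Group (G i)] {H : Type*} [Group H]

/-- The product in the free product of a list of letters. -/
def listProd (l : List (Σ i, G i)) : CoprodI G :=
  (l.map fun p => CoprodI.of p.2).prod

/-- The product of the values of an odd map along a list of letters. -/
def evalList (a : OddMap G H) (l : List (Σ i, G i)) : H := (l.map a.val).prod

@[simp] lemma evalList_nil (a : OddMap G H) : a.evalList [] = 1 := rfl

@[simp] lemma evalList_cons (a : OddMap G H) (p : Σ i, G i) (l : List (Σ i, G i)) :
    a.evalList (p :: l) = a.val p * a.evalList l := by simp [evalList]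

@[simp] lemma evalList_append (a : OddMap G H) (l l' : List (Σ i, G i)) :
    a.evalList (l ++ l') = a.evalList l * a.evalList l' := by simp [evalList]

@[simp] lemma listProd_nil : listProd ([] : List (Σ i, G i)) = 1 := rfl

@[simp] lemma listProd_cons (p : Σ i, G i) (l : List (Σ i, G i)) :
    listProd (p :: l) = CoprodI.of p.2 * listProd l := by simp [listProd]

@[simp] lemma listProd_append (l l' : List (Σ i, G i)) :
    listProd (l ++ l') = listProd l * listProd l' := by simp [listProd]

open Classical in
/-- The list of letters of the reduced word of an element. -/
noncomputable def letters (g : CoprodI G) : List (Σ i, G i) := (CoprodI.Word.equiv g).toList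

lemma isReducedList_letters (g : CoprodI G) : IsReducedList (letters g) := by
  classical
  exact ⟨fun p hp => (CoprodI.Word.equiv g).ne_one p hp, (CoprodI.Word.equiv g).chain_ne⟩

lemma listProd_letters (g : CoprodI G) : listProd (letters g) = g := by
  classical
  exact CoprodI.Word.equiv.symm_apply_apply g

lemma letters_listProd {l : List (Σ i, G i)} (hl : IsReducedList l) :
    letters (listProd l) = l := by
  classical
  have := CoprodI.Word.equiv.apply_symm_apply (⟨l, hl.1, hl.2⟩ : CoprodI.Word G)
  exact congrArg CoprodI.Word.toList this

/-- The value of an odd map on an element: the product of its values along the reduced word. -/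
noncomputable def eval (a : OddMap G H) (g : CoprodI G) : H := a.evalList (letters g)

lemma eval_listProd (a : OddMap G H) {l : List (Σ i, G i)} (hl : IsReducedList l) :
    a.eval (listProd l) = a.evalList l := by
  rw [eval, letters_listProd hl]

/-- Reducing the concatenation of two reduced words uses only one nontrivial multiplication in a
factor. -/
lemma exists_reduced_mul (l : List (Σ i, G i)) (hl : IsReducedList l) :
    ∀ l₂ : List (Σ i, G i), IsReducedList l₂ → ∃ l₃, IsReducedList l₃ ∧
      listProd l₃ = listProd l * listProd l₂ ∧
      ((∀ a : OddMap G H, a.evalList l₃ = a.evalList l * a.evalList l₂) ∨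
        ∃ i, ∃ s t : G i, ∀ a : OddMap G H, a.val ⟨i, s * t⟩ = a.val ⟨i, s⟩ * a.val ⟨i, t⟩ →
          a.evalList l₃ = a.evalList l * a.evalList l₂) := by
  induction l using List.reverseRecOn with
  | nil => exact fun l₂ h₂ => ⟨l₂, h₂, by simp, Or.inl (by simp)⟩
  | append_singleton l p ih =>
    intro l₂ h₂
    have hl' : IsReducedList l :=
      ⟨fun q hq => hl.1 q (by simp [hq]), (List.isChain_append.1 hl.2).1⟩
    rcases l₂ with _ | ⟨q, l₂⟩
    · exact ⟨l ++ [p], hl, by simp, Or.inl (by simp)⟩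
    have h₂' : IsReducedList l₂ :=
      ⟨fun q hq => h₂.1 q (by simp [hq]), h₂.2.tail⟩
    by_cases hpq : p.1 = q.1
    · obtain ⟨i, s⟩ := p
      obtain ⟨j, t⟩ := q
      obtain rfl : i = j := hpq
      by_cases hst : s * t = 1
      · obtain ⟨l₃, h₃, hp₃, he₃⟩ := ih hl' l₂ h₂'
        have ht : t = s⁻¹ := (inv_eq_of_mul_eq_one_right hst).symm
        subst ht
        refine ⟨l₃, h₃, ?_, ?_⟩
        · simp [hp₃, mul_assoc]
        · simpa [OddMap.val_inv, mul_assoc] using he₃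
      · refine ⟨l ++ ⟨i, s * t⟩ :: l₂, ⟨?_, ?_⟩, ?_, Or.inr ⟨i, s, t, ?_⟩⟩
        · intro q hq
          rcases List.mem_append.1 hq with hq | hq
          · exact hl'.1 q hq
          · rcases List.mem_cons.1 hq with rfl | hq
            · exact hst
            · exact h₂'.1 q hq
        · have h1 := hl.2
          have h2 := h₂.2
          rw [List.isChain_append] at h1 ⊢
          refine ⟨h1.1, ?_, ?_⟩
          · rw [List.isChain_cons] at h2 ⊢
            exact h2
          · simpa using h1.2.2
        · simp [mul_assoc]
        · intro a ha
          simp [ha, mul_assoc]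
    · refine ⟨(l ++ [p]) ++ q :: l₂, ⟨?_, ?_⟩, listProd_append _ _, Or.inl fun a => a.evalList_append _ _⟩
      · intro r hr
        rcases List.mem_append.1 hr with hr | hr
        · exact hl.1 r hr
        · exact h₂.1 r hr
      · rw [List.isChain_append]
        exact ⟨hl.2, h₂.2, by simpa using hpq⟩

/-- The critical letters `s`, `t` depend on `g` and `h` but not on `a`; this uniformity is what
permits counting over a family. -/
lemma eval_mul (g h : CoprodI G) :
    (∀ a : OddMap G H, a.eval (g * h) = a.eval g * a.eval h) ∨
      ∃ i, ∃ s t : G i, ∀ a : OddMap G H, a.val ⟨i, s * t⟩ = a.val ⟨i, s⟩ * a.val ⟨i, t⟩ →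
        a.eval (g * h) = a.eval g * a.eval h := by
  obtain ⟨l₃, h₃, hp, he⟩ := exists_reduced_mul (H := H) (letters g) (isReducedList_letters g)
    (letters h) (isReducedList_letters h)
  have h1 : letters (g * h) = l₃ := by
    rw [← letters_listProd h₃, hp, listProd_letters, listProd_letters]
  simpa only [eval, h1] using he

lemma eval_one (a : OddMap G H) : a.eval 1 = 1 := by
  have : IsReducedList ([] : List (Σ i, G i)) := ⟨by simp, by simp⟩
  simpa using a.eval_listProd this

/-- The letters of the inverse of a word. -/
def invList (l : List (Σ i, G i)) : List (Σ i, G i) := (l.map fun p => ⟨p.1, p.2⁻¹⟩).reverse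

lemma eval_inv (a : OddMap G H) (g : CoprodI G) : a.eval g⁻¹ = (a.eval g)⁻¹ := by
  have hr := isReducedList_letters g
  have h1 : IsReducedList (invList (letters g)) := by
    refine ⟨?_, ?_⟩
    · intro p hp
      simp only [invList, List.mem_reverse, List.mem_map] at hp
      obtain ⟨q, hq, rfl⟩ := hp
      simpa using hr.1 q hq
    · rw [invList, List.isChain_reverse, List.isChain_map]
      exact hr.2.imp fun p q h => h.symm
  have h2 : ∀ l : List (Σ i, G i), listProd (invList l) = (listProd l)⁻¹ := by
    intro l
    induction l with
    | nil => simp [invList]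
    | cons p l ih => rw [listProd_cons, mul_inv_rev, ← ih]; simp [invList]
  have h3 : ∀ l : List (Σ i, G i), a.evalList (invList l) = (a.evalList l)⁻¹ := by
    intro l
    induction l with
    | nil => simp [invList]
    | cons p l ih => rw [evalList_cons, mul_inv_rev, ← ih]; simp [invList, a.val_inv]
  have h4 := a.eval_listProd h1
  rwa [h2, h3, listProd_letters] at h4

/-- The odd map given by a homomorphism. -/
def ofHom (f : CoprodI G →* H) : OddMap G H where
  val p := f (CoprodI.of p.2)
  val_one i := by simp
  val_inv i s := by simp

lemma eval_ofHom (f : CoprodI G →* H) (g : CoprodI G) : (ofHom f).eval g = f g := by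
  conv_rhs => rw [← listProd_letters g]
  rw [listProd, map_list_prod]
  simp [eval, evalList, ofHom, Function.comp_def]

open Classical in
/-- Change an odd map at `k` and `k⁻¹` only. -/
noncomputable def update (a : OddMap G H) (i : ι) (k : G i) (hk : k ≠ k⁻¹) (c : H) : OddMap G H where
  -- As `k ≠ k⁻¹`, oddness puts no constraint on `c`.
  val p := if p = ⟨i, k⟩ then c else if p = ⟨i, k⁻¹⟩ then c⁻¹ else a.val p
  val_one j := by
    have h : k ≠ 1 := fun h => hk (by simp [h])
    rw [if_neg, if_neg, a.val_one]
    · rintro h1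
      obtain ⟨rfl, h1⟩ := Sigma.mk.inj_iff.1 h1
      exact h (inv_eq_one.1 (eq_of_heq h1).symm)
    · rintro h1
      obtain ⟨rfl, h1⟩ := Sigma.mk.inj_iff.1 h1
      exact h (eq_of_heq h1).symm
  val_inv j s := by
    by_cases hj : i = j
    · subst hj
      by_cases h1 : s = k
      · subst h1
        simp [hk.symm]
      · by_cases h2 : s = k⁻¹
        · subst h2
          simp [hk.symm]
        · have h3 : s⁻¹ ≠ k := fun h => h2 (by rw [← h, inv_inv])
          simp [h1, h2, h3, a.val_inv]
    · have : ∀ (t : G j) (u : G i), (⟨j, t⟩ : Σ i, G i) ≠ ⟨i, u⟩ := fun t u h =>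
        hj (Sigma.mk.inj_iff.1 h).1.symm
      simp [this, a.val_inv]

lemma update_self (a : OddMap G H) (i : ι) (k : G i) (hk : k ≠ k⁻¹) (c : H) :
    (a.update i k hk c).val ⟨i, k⟩ = c := by simp [update]

lemma update_of_ne (a : OddMap G H) (i : ι) (k : G i) (hk : k ≠ k⁻¹) (c : H) {p : Σ i, G i}
    (h1 : p ≠ ⟨i, k⟩) (h2 : p ≠ ⟨i, k⁻¹⟩) : (a.update i k hk c).val p = a.val p := by
  simp [update, h1, h2]

end OddMap

/-! ### Densities in finite index sets -/

/-- A subset of a finite type has density at most `ε`. -/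
def DensityLE {J : Type*} (ε : ℝ) (s : Set J) : Prop := (s.ncard : ℝ) ≤ ε * Nat.card J

namespace DensityLE

variable {J : Type*} {ε δ : ℝ} {s t : Set J}

lemma mono [Finite J] (h : DensityLE ε t) (hst : s ⊆ t) (hε : ε ≤ δ) : DensityLE δ s := by
  have h1 : (s.ncard : ℝ) ≤ t.ncard := by exact_mod_cast Set.ncard_le_ncard hst
  exact (h1.trans h).trans (by gcongr)

lemma union (hs : DensityLE ε s) (ht : DensityLE δ t) : DensityLE (ε + δ) (s ∪ t) := by
  have h1 : ((s ∪ t).ncard : ℝ) ≤ s.ncard + t.ncard := by exact_mod_cast Set.ncard_union_le s t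
  unfold DensityLE at *
  linarith

lemma empty (hε : 0 ≤ ε) : DensityLE ε (∅ : Set J) := by
  unfold DensityLE
  simp only [Set.ncard_empty, Nat.cast_zero]
  positivity

lemma exists_notMem [Finite J] [Nonempty J] (h : DensityLE ε s) (hε : ε < 1) : ∃ j, j ∉ s := by
  by_contra! hs
  have : s = Set.univ := Set.eq_univ_of_forall hs
  subst this
  have h0 : (0 : ℝ) < Nat.card J := by exact_mod_cast Nat.card_pos
  unfold DensityLE at h
  rw [Set.ncard_univ] at h
  nlinarith

lemma iUnion_fin [Finite J] {m : ℕ} {s : Fin m → Set J} (h : ∀ i, DensityLE ε (s i)) :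
    DensityLE (m * ε) (⋃ i, s i) := by
  induction m with
  | zero => simpa using empty le_rfl
  | succ m ih =>
    have h1 : ⋃ i, s i = (⋃ i : Fin m, s i.castSucc) ∪ s (Fin.last m) := by
      ext j
      simp [Fin.exists_fin_succ']
    rw [h1]
    exact ((ih fun i => h i.castSucc).union (h _)).mono subset_rfl (by push_cast; linarith)

end DensityLE

lemma ncard_fst_preimage {J : Type*} (N : ℕ) (s : Set J) :
    {p : J × Fin N | p.1 ∈ s}.ncard = s.ncard * N := by
  have : {p : J × Fin N | p.1 ∈ s} = s ×ˢ Set.univ := by ext; simp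
  rw [this, Set.ncard_prod, Set.ncard_univ, Nat.card_fin]

lemma ncard_snd_preimage {J : Type*} (N : ℕ) (s : Set (Fin N)) :
    {p : J × Fin N | p.2 ∈ s}.ncard = Nat.card J * s.ncard := by
  have : {p : J × Fin N | p.2 ∈ s} = Set.univ ×ˢ s := by ext; simp
  rw [this, Set.ncard_prod, Set.ncard_univ]

lemma DensityLE.fst_preimage {J : Type*} {ε : ℝ} {s : Set J} (h : DensityLE ε s) (N : ℕ) :
    DensityLE ε {p : J × Fin N | p.1 ∈ s} := by
  unfold DensityLE at *
  rw [ncard_fst_preimage, Nat.card_prod, Nat.card_fin]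
  push_cast
  rw [← mul_assoc]
  gcongr

lemma DensityLE.of_fst_preimage {J : Type*} {ε : ℝ} {s : Set J} {N : ℕ} (hN : 0 < N)
    (h : DensityLE ε {p : J × Fin N | p.1 ∈ s}) : DensityLE ε s := by
  unfold DensityLE at *
  rw [ncard_fst_preimage, Nat.card_prod, Nat.card_fin] at h
  push_cast at h
  rw [← mul_assoc] at h
  exact le_of_mul_le_mul_right h (by exact_mod_cast hN)

/-- High positive powers of an element of infinite order work: no two are mutually inverse, and the
exponents exceed all those occurring in `S`. -/
lemma exists_distinct_letters {K : Type*} [Group K] (t : K) (ht : Function.Injective fun n : ℤ => t ^ n)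
    (S : Set K) (hS : S.Finite) (N : ℕ) :
    ∃ k : Fin N → K, Function.Injective k ∧ (∀ i j, k i ≠ (k j)⁻¹) ∧
      ∀ i, k i ∉ S ∧ (k i)⁻¹ ∉ S := by
  have hfin : ((fun n : ℤ => t ^ n) ⁻¹' S).Finite := hS.preimage ht.injOn
  obtain ⟨M, hM⟩ := (hfin.image Int.natAbs).bddAbove
  have hbd : ∀ n : ℤ, t ^ n ∈ S → n.natAbs ≤ M := fun n hn => hM ⟨n, hn, rfl⟩
  refine ⟨fun i => t ^ ((M : ℤ) + 1 + i), ?_, ?_, ?_⟩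
  · intro i j hij
    have := ht hij
    ext
    omega
  · intro i j hij
    rw [← zpow_neg] at hij
    have := ht hij
    omega
  · intro i
    refine ⟨fun h => ?_, fun h => ?_⟩
    · have := hbd _ h
      omega
    · rw [← zpow_neg] at h
      have := hbd _ h
      omega

/-! ### Almost multiplicative families and their extension -/

namespace OddMap

variable {ι : Type*} {G : ι → Type*} [∀ i, Group (G i)] {H : Type*} [Group H]

/-- In a family of odd maps, every instance of multiplicativity fails only for few members. -/
def IsAlmostMul {J : Type*} (ε : ℝ) (a : J → OddMap G H) : Prop :=
  ∀ i, ∀ s t : G i,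
    DensityLE ε {j | (a j).val ⟨i, s * t⟩ ≠ (a j).val ⟨i, s⟩ * (a j).val ⟨i, t⟩}

lemma IsAlmostMul.mono {J : Type*} [Finite J] {ε δ : ℝ} {a : J → OddMap G H}
    (ha : IsAlmostMul ε a) (h : ε ≤ δ) : IsAlmostMul δ a :=
  fun i s t => (ha i s t).mono subset_rfl h

/-- The bound does not deteriorate with word length, since at most one letter multiplication is at
stake. -/
lemma IsAlmostMul.eval {J : Type*} [Finite J] {ε : ℝ} (hε : 0 ≤ ε) {a : J → OddMap G H}
    (ha : IsAlmostMul ε a) (g h : CoprodI G) :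
    DensityLE ε {j | (a j).eval (g * h) ≠ (a j).eval g * (a j).eval h} := by
  rcases eval_mul (H := H) g h with h1 | ⟨i, s, t, h1⟩
  · simpa [h1] using DensityLE.empty hε
  · exact (ha i s t).mono (fun j hj h2 => hj (h1 _ h2)) le_rfl

/-- The letters `k 1, s, k 2, s, …` indexed by a list. -/
def alternating {I : Type*} {i₀ i₁ : ι} (k : I → G i₀) (s : G i₁) (l : List I) :
    List (Σ i, G i) :=
  l.flatMap fun n => [⟨i₀, k n⟩, ⟨i₁, s⟩]

lemma isReducedList_alternating {I : Type*} {i₀ i₁ : ι} (hi : i₀ ≠ i₁) {k : I → G i₀} {s : G i₁}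
    (hk : ∀ n, k n ≠ 1) (hs : s ≠ 1) (l : List I) : IsReducedList (alternating k s l) := by
  refine ⟨?_, ?_⟩
  · intro p hp
    simp only [alternating, List.mem_flatMap, List.mem_cons, List.not_mem_nil, or_false] at hp
    obtain ⟨n, -, rfl | rfl⟩ := hp
    · exact hk n
    · exact hs
  · induction l with
    | nil => simp [alternating]
    | cons n l ih =>
      have : alternating k s (n :: l) = ⟨i₀, k n⟩ :: ⟨i₁, s⟩ :: alternating k s l := rfl
      rw [this]
      refine List.IsChain.cons_cons hi ?_
      cases l with
      | nil => simp [alternating]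
      | cons m l => exact List.IsChain.cons_cons hi.symm ih

/-- The letter `k n` occurs exactly once and its inverse never, so the value of the word is `u * c *
w` with `u`, `w` independent of `c`; solve for `c`. -/
lemma exists_evalList_alternating_eq {I : Type*} {i₀ i₁ : ι} (hi : i₀ ≠ i₁) {k : I → G i₀}
    (s : G i₁) (hinj : Function.Injective k) (hinv : ∀ m n, k m ≠ (k n)⁻¹) {l : List I}
    (hl : l.Nodup) {n : I} (hn : n ∈ l) (a : OddMap G H) (b : H) :
    ∃ c, (a.update i₀ (k n) (hinv n n) c).evalList (alternating k s l) = b := by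
  obtain ⟨l₁, l₂, rfl⟩ := List.append_of_mem hn
  have hs : ∀ c, (a.update i₀ (k n) (hinv n n) c).val ⟨i₁, s⟩ = a.val ⟨i₁, s⟩ := fun c =>
    update_of_ne _ _ _ _ _ (fun h => hi (Sigma.mk.inj_iff.1 h).1.symm)
      (fun h => hi (Sigma.mk.inj_iff.1 h).1.symm)
  have hconst : ∀ c, ∀ l' : List I, n ∉ l' →
      (a.update i₀ (k n) (hinv n n) c).evalList (alternating k s l') =
        a.evalList (alternating k s l') := by
    intro c l' hl'
    refine congrArg List.prod (List.map_congr_left fun p hp => ?_)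
    simp only [alternating, List.mem_flatMap, List.mem_cons, List.not_mem_nil, or_false] at hp
    obtain ⟨m, hm, rfl | rfl⟩ := hp
    · have hmn : m ≠ n := fun h => hl' (h ▸ hm)
      exact update_of_ne _ _ _ _ _ (fun h => hmn (hinj (eq_of_heq (Sigma.mk.inj_iff.1 h).2)))
        (fun h => hinv m n (eq_of_heq (Sigma.mk.inj_iff.1 h).2))
    · exact hs c
  have hnd := List.nodup_append.1 hl
  have h1 : n ∉ l₁ := fun h => hnd.2.2 n h n (by simp) rfl
  have h2 : n ∉ l₂ := (List.nodup_cons.1 hnd.2.1).1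
  refine ⟨(a.evalList (alternating k s l₁))⁻¹ * b *
    (a.val ⟨i₁, s⟩ * a.evalList (alternating k s l₂))⁻¹, ?_⟩
  have : alternating k s (l₁ ++ n :: l₂) =
      alternating k s l₁ ++ ⟨i₀, k n⟩ :: ⟨i₁, s⟩ :: alternating k s l₂ := by
    simp [alternating]
  rw [this, evalList_append, evalList_cons, evalList_cons, hconst _ _ h1, hconst _ _ h2, hs,
    update_self]
  group

/-- A family of odd maps can be modified so that a new element takes prescribed values, while the
values on finitely many given elements are kept. -/
lemma IsAlmostMul.exists_extension {i₀ i₁ : ι} (hi : i₀ ≠ i₁) {t : G i₀}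
    (ht : Function.Injective fun n : ℤ => t ^ n) {s : G i₁} (hs : s ≠ 1)
    {J : Type*} [Finite J] {ε δ : ℝ} (hδ : 0 < δ) {a : J → OddMap G H} (ha : IsAlmostMul ε a)
    (A : Set (CoprodI G)) (hA : A.Finite) (b : J → H) :
    ∃ N : ℕ, 0 < N ∧ ∃ x, ∃ a' : J × Fin N → OddMap G H, IsAlmostMul (ε + δ) a' ∧
      (∀ p, ∀ g ∈ A, (a' p).eval g = (a p.1).eval g) ∧ ∀ p, (a' p).eval x = b p.1 := by
  -- An instance of multiplicativity involves three letters, each altered in at most one of the N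
  -- copies, so it suffices that `3 / N` is below `δ`.
  obtain ⟨N, hN⟩ := exists_nat_gt (3 / δ)
  have hN0 : (0 : ℝ) < N := lt_trans (by positivity) hN
  have hS : {u : G i₀ | ∃ g ∈ A, (⟨i₀, u⟩ : Σ i, G i) ∈ letters g}.Finite := by
    have : (⋃ g ∈ A, (Sigma.mk i₀) ⁻¹' {p | p ∈ letters g}).Finite :=
      hA.biUnion fun g _ => (List.finite_toSet (letters g)).preimage sigma_mk_injective.injOn
    refine this.subset ?_
    rintro u ⟨g, hg, hu⟩
    exact Set.mem_biUnion hg hu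
  obtain ⟨k, hinj, hinv, hk⟩ := exists_distinct_letters t ht _ hS N
  have hk1 : ∀ n, k n ≠ 1 := fun n h => hinv n n (by simp [h])
  have hex : ∀ p : J × Fin N, ∃ c, ((a p.1).update i₀ (k p.2) (hinv p.2 p.2) c).evalList
      (alternating k s (List.finRange N)) = b p.1 := fun p =>
    exists_evalList_alternating_eq hi s hinj hinv (List.nodup_finRange N) (List.mem_finRange p.2)
      (a p.1) (b p.1)
  choose c hc using hex
  -- The word is the same for all members, but copy `n` attains the target by altering only its own
  -- letter `k n`.
  refine ⟨N, by exact_mod_cast hN0, listProd (alternating k s (List.finRange N)),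
    fun p => (a p.1).update i₀ (k p.2) (hinv p.2 p.2) (c p), ?_, ?_, ?_⟩
  · intro i u v
    set T : G i → Set (Fin N) := fun w =>
      {n | (⟨i, w⟩ : Σ i, G i) = ⟨i₀, k n⟩ ∨ (⟨i, w⟩ : Σ i, G i) = ⟨i₀, (k n)⁻¹⟩} with hT
    have hT1 : ∀ w, (T w).ncard ≤ 1 := by
      intro w
      rw [Set.ncard_le_one]
      rintro m hm n hn
      have hmn : ∀ x y : G i₀, (⟨i, w⟩ : Σ i, G i) = ⟨i₀, x⟩ → (⟨i, w⟩ : Σ i, G i) = ⟨i₀, y⟩ →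
          x = y := fun x y hx hy =>
        eq_of_heq (Sigma.mk.inj_iff.1 (hx.symm.trans hy)).2
      rcases hm with hm | hm <;> rcases hn with hn | hn
      · exact hinj (hmn _ _ hm hn)
      · exact absurd (hmn _ _ hm hn) (hinv _ _)
      · exact absurd (hmn _ _ hn hm) (hinv _ _)
      · exact hinj (inv_injective (hmn _ _ hm hn))
    have hT3 : (T u ∪ T v ∪ T (u * v)).ncard ≤ 3 := by
      have h1 := Set.ncard_union_le (T u ∪ T v) (T (u * v))
      have h2 := Set.ncard_union_le (T u) (T v)
      have := hT1 u
      have := hT1 v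
      have := hT1 (u * v)
      omega
    have hval : ∀ p : J × Fin N, ∀ w : G i, p.2 ∉ T w →
        ((a p.1).update i₀ (k p.2) (hinv p.2 p.2) (c p)).val ⟨i, w⟩ = (a p.1).val ⟨i, w⟩ := by
      intro p w hp
      simp only [hT, Set.mem_ofPred_eq, not_or] at hp
      exact update_of_ne _ _ _ _ _ hp.1 hp.2
    have hsmall : DensityLE δ {p : J × Fin N | p.2 ∈ T u ∪ T v ∪ T (u * v)} := by
      unfold DensityLE
      rw [ncard_snd_preimage, Nat.card_prod, Nat.card_fin]
      rw [div_lt_iff₀ hδ] at hN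
      have h3 : ((T u ∪ T v ∪ T (u * v)).ncard : ℝ) ≤ 3 := by exact_mod_cast hT3
      replace h3 : ((T u ∪ T v ∪ T (u * v)).ncard : ℝ) ≤ δ * N := by linarith
      push_cast
      calc (Nat.card J : ℝ) * (T u ∪ T v ∪ T (u * v)).ncard ≤ Nat.card J * (δ * N) := by gcongr
        _ = δ * (Nat.card J * N) := by ring
    refine (((ha i u v).fst_preimage N).union hsmall).mono ?_ le_rfl
    intro p hp
    by_contra hcon
    simp only [Set.mem_union, Set.mem_ofPred_eq, not_or, not_not, ne_eq] at hcon hp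
    obtain ⟨h1, ⟨h2, h3⟩, h4⟩ := hcon
    rw [hval p _ h2, hval p _ h3, hval p _ h4] at hp
    exact hp h1
  · intro p g hg
    refine congrArg List.prod (List.map_congr_left fun q hq => ?_)
    refine update_of_ne _ _ _ _ _ ?_ ?_
    · rintro rfl
      exact (hk p.2).1 ⟨g, hg, hq⟩
    · rintro rfl
      exact (hk p.2).2 ⟨g, hg, hq⟩
  · intro p
    rw [eval_listProd _ (isReducedList_alternating hi hk1 hs _), hc]

end OddMap

open Monoid FirstOrder Language

/-! ### Semantics of group formulas with parameters -/

section Logic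

variable {P : Type*} [Group P] {K : Type*} [Group K] {β : Type*} {α : Type*} {k : ℕ}

/-- The value of a term with parameters from `P`, which are read in `K` along a homomorphism. -/
def termVal (f : P →* K) (t : (groupLanguage[[P]]).Term β) (v : β → K) : K :=
  letI : (constantsOn P).Structure K := constantsOn.structure f
  t.realize v

/-- Truth of a formula with parameters from `P`, which are read in `K` along a homomorphism. -/
def Holds (f : P →* K) (φ : (groupLanguage[[P]]).BoundedFormula α k) (v : α → K)
    (xs : Fin k → K) : Prop :=
  letI : (constantsOn P).Structure K := constantsOn.structure f
  φ.Realize v xs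

lemma satisfiedBy_iff_holds {n m : ℕ} (f : FreeGroup (Fin n) →* K) (φ : FormulaOver n m)
    (x : Fin m → K) (xs : Fin 0 → K) : SatisfiedBy f φ x ↔ Holds f φ x xs := by
  rw [Subsingleton.elim xs default]
  rfl

lemma holds_equal (f : P →* K) (t₁ t₂ : (groupLanguage[[P]]).Term (α ⊕ Fin k)) (v : α → K)
    (xs : Fin k → K) : Holds f (t₁.bdEqual t₂) v xs ↔
      termVal f t₁ (Sum.elim v xs) = termVal f t₂ (Sum.elim v xs) := Iff.rfl

lemma holds_falsum (f : P →* K) (v : α → K) (xs : Fin k → K) :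
    ¬ Holds f (⊥ : (groupLanguage[[P]]).BoundedFormula α k) v xs := id

lemma holds_inf (f : P →* K) (φ ψ : (groupLanguage[[P]]).BoundedFormula α k) (v : α → K)
    (xs : Fin k → K) : Holds f (φ ⊓ ψ) v xs ↔ Holds f φ v xs ∧ Holds f ψ v xs :=
  letI : (constantsOn P).Structure K := constantsOn.structure f
  BoundedFormula.realize_inf

lemma holds_sup (f : P →* K) (φ ψ : (groupLanguage[[P]]).BoundedFormula α k) (v : α → K)
    (xs : Fin k → K) : Holds f (φ ⊔ ψ) v xs ↔ Holds f φ v xs ∨ Holds f ψ v xs :=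
  letI : (constantsOn P).Structure K := constantsOn.structure f
  BoundedFormula.realize_sup

lemma holds_all (f : P →* K) (φ : (groupLanguage[[P]]).BoundedFormula α (k + 1)) (v : α → K)
    (xs : Fin k → K) : Holds f φ.all v xs ↔ ∀ x, Holds f φ v (Fin.snoc xs x) := Iff.rfl

lemma holds_ex (f : P →* K) (φ : (groupLanguage[[P]]).BoundedFormula α (k + 1)) (v : α → K)
    (xs : Fin k → K) : Holds f φ.ex v xs ↔ ∃ x, Holds f φ v (Fin.snoc xs x) :=
  letI : (constantsOn P).Structure K := constantsOn.structure f
  BoundedFormula.realize_ex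

/-- Induction on the terms of the language of groups with parameters. -/
lemma groupTerm_induction {P β : Type*} {p : (groupLanguage[[P]]).Term β → Prop} (var : ∀ b, p (.var b))
    (mul : ∀ ts : Fin 2 → (groupLanguage[[P]]).Term β, p (ts 0) → p (ts 1) →
      p (.func (Sum.inl GroupFunc.mul) ts))
    (inv : ∀ ts : Fin 1 → (groupLanguage[[P]]).Term β, p (ts 0) →
      p (.func (Sum.inl GroupFunc.inv) ts))
    (one : ∀ ts : Fin 0 → (groupLanguage[[P]]).Term β, p (.func (Sum.inl GroupFunc.one) ts))
    (const : ∀ (c : P) (ts : Fin 0 → (groupLanguage[[P]]).Term β), p (.func (l := 0) (Sum.inr c) ts))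
    (t : (groupLanguage[[P]]).Term β) : p t := by
  induction t with
  | var b => exact var b
  | @func l f ts ih =>
    rcases f with f | c
    · rcases (f : GroupFunc l) with _ | _ | _
      · exact mul ts (ih 0) (ih 1)
      · exact inv ts (ih 0)
      · exact one ts
    · rcases l with _ | l
      · exact const c ts
      · exact isEmptyElim (α := (constantsOn P).Functions (l + 1)) c

lemma termVal_var (f : P →* K) (b : β) (v : β → K) : termVal f (.var b) v = v b := rfl

lemma termVal_mul (f : P →* K) (ts : Fin 2 → (groupLanguage[[P]]).Term β) (v : β → K) :
    termVal f (.func (Sum.inl GroupFunc.mul) ts) v =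
      termVal f (ts 0) v * termVal f (ts 1) v := rfl

lemma termVal_inv (f : P →* K) (ts : Fin 1 → (groupLanguage[[P]]).Term β) (v : β → K) :
    termVal f (.func (Sum.inl GroupFunc.inv) ts) v = (termVal f (ts 0) v)⁻¹ := rfl

lemma termVal_one (f : P →* K) (ts : Fin 0 → (groupLanguage[[P]]).Term β) (v : β → K) :
    termVal f (.func (Sum.inl GroupFunc.one) ts) v = 1 := rfl

lemma termVal_const (f : P →* K) (c : P) (ts : Fin 0 → (groupLanguage[[P]]).Term β) (v : β → K) :
    termVal f (.func (l := 0) (Sum.inr c) ts) v = f c := rfl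

lemma map_termVal {H : Type*} [Group H] (h : K →* H) (f : P →* K)
    (t : (groupLanguage[[P]]).Term β) (v : β → K) :
    h (termVal f t v) = termVal (h.comp f) t (h ∘ v) := by
  induction t using groupTerm_induction with
  | var b => rfl
  | mul ts h0 h1 => simp [termVal_mul, h0, h1]
  | inv ts h0 => simp [termVal_inv, h0]
  | one ts => simp [termVal_one]
  | const c ts => rfl

lemma isEmpty_relations (P : Type*) (l : ℕ) : IsEmpty ((groupLanguage[[P]]).Relations l) :=
  inferInstanceAs (IsEmpty (Empty ⊕ Empty))

/-- Positive formulas are preserved by surjective homomorphisms. -/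
lemma IsPositive.holds_of_surjective {H : Type*} [Group H] {h : K →* H}
    (hh : Function.Surjective h) (f : P →* K) {φ : (groupLanguage[[P]]).BoundedFormula α k}
    (hφ : IsPositive φ) (v : α → K) (xs : Fin k → K) (hv : Holds f φ v xs) :
    Holds (h.comp f) φ (h ∘ v) (h ∘ xs) := by
  induction hφ with
  | falsum => exact (holds_falsum _ _ _ hv).elim
  | equal t₁ t₂ =>
    rw [holds_equal] at hv ⊢
    rw [← Sum.comp_elim, ← map_termVal, ← map_termVal, hv]
  | rel R ts => exact (isEmpty_relations P _).elim R
  | inf _ _ ih₁ ih₂ =>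
    rw [holds_inf] at hv ⊢
    exact ⟨ih₁ _ hv.1, ih₂ _ hv.2⟩
  | sup _ _ ih₁ ih₂ =>
    rw [holds_sup] at hv ⊢
    exact hv.imp (ih₁ _) (ih₂ _)
  | all _ ih =>
    rw [holds_all] at hv ⊢
    intro y
    obtain ⟨x, rfl⟩ := hh y
    rw [← Fin.comp_snoc]
    exact ih _ (hv x)
  | ex _ ih =>
    rw [holds_ex] at hv ⊢
    obtain ⟨x, hx⟩ := hv
    refine ⟨h x, ?_⟩
    rw [← Fin.comp_snoc]
    exact ih _ hx

end Logic

/-! ### Transfer of positive formulas along almost multiplicative families -/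

section Transfer

variable {P : Type*} [Group P] {ι : Type*} {G : ι → Type*} [∀ i, Group (G i)]
  {H : Type*} [Group H]

open OddMap

/-- A term commutes with most members of an almost multiplicative family that respects its
parameters. -/
lemma exists_termVal_eval (e : P ≃* CoprodI G) (f : P →* H) {β : Type*}
    (t : (groupLanguage[[P]]).Term β) (δ : ℝ) (hδ : 0 < δ) :
    ∃ ε > 0, ∃ A : Set P, A.Finite ∧ ∀ (J : Type) [Finite J] (a : J → OddMap G H),
      IsAlmostMul ε a → (∀ j, ∀ c ∈ A, (a j).eval (e c) = f c) → ∀ v : β → P,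
      DensityLE δ {j | (a j).eval (e (termVal (MonoidHom.id P) t v)) ≠
        termVal f t fun b => (a j).eval (e (v b))} := by
  induction t using groupTerm_induction generalizing δ with
  | var b =>
    exact ⟨1, one_pos, ∅, Set.finite_empty, fun J _ a _ _ v => by
      simpa [termVal_var] using DensityLE.empty hδ.le⟩
  | mul ts h0 h1 =>
    obtain ⟨ε₀, hε₀, A₀, hA₀, h0⟩ := h0 (δ / 3) (by positivity)
    obtain ⟨ε₁, hε₁, A₁, hA₁, h1⟩ := h1 (δ / 3) (by positivity)
    refine ⟨min (min ε₀ ε₁) (δ / 3), by positivity, A₀ ∪ A₁, hA₀.union hA₁,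
      fun J _ a ha hc v => ?_⟩
    have ha₀ : IsAlmostMul ε₀ a := ha.mono (by simp)
    have ha₁ : IsAlmostMul ε₁ a := ha.mono (by simp)
    have ha₂ : IsAlmostMul (δ / 3) a := ha.mono (by simp)
    refine ((((h0 J a ha₀ (fun j c h => hc j c (Or.inl h)) v).union
      (h1 J a ha₁ (fun j c h => hc j c (Or.inr h)) v)).union
      (ha₂.eval (by positivity) (e (termVal (MonoidHom.id P) (ts 0) v))
        (e (termVal (MonoidHom.id P) (ts 1) v))))).mono ?_ (by linarith)
    intro j hj
    by_contra hcon
    simp only [Set.mem_union, Set.mem_ofPred_eq, not_or, not_not, ne_eq] at hcon hj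
    rw [termVal_mul, termVal_mul, map_mul, hcon.2, hcon.1.1, hcon.1.2] at hj
    exact hj rfl
  | inv ts h0 =>
    obtain ⟨ε₀, hε₀, A₀, hA₀, h0⟩ := h0 δ hδ
    refine ⟨ε₀, hε₀, A₀, hA₀, fun J _ a ha hc v => ?_⟩
    simpa only [termVal_inv, map_inv, eval_inv, ne_eq, inv_inj] using h0 J a ha hc v
  | one ts =>
    exact ⟨1, one_pos, ∅, Set.finite_empty, fun J _ a _ _ v => by
      simpa [termVal_one, eval_one] using DensityLE.empty hδ.le⟩
  | const c ts =>
    refine ⟨1, one_pos, {c}, Set.finite_singleton c, fun J _ a _ hc v => ?_⟩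
    simpa [termVal_const, fun j => hc j c rfl] using DensityLE.empty hδ.le

/-- A positive formula that is true in a free product stays true under most members of an almost
multiplicative family that respects its parameters. -/
lemma IsPositive.exists_holds_eval (e : P ≃* CoprodI G) (f : P →* H) {i₀ i₁ : ι} (hi : i₀ ≠ i₁)
    {t : G i₀} (ht : Function.Injective fun n : ℤ => t ^ n) {s : G i₁} (hs : s ≠ 1)
    {α : Type*} [Finite α] {k : ℕ} {φ : (groupLanguage[[P]]).BoundedFormula α k}
    (hφ : IsPositive φ) (δ : ℝ) (hδ : 0 < δ) :
    ∃ ε > 0, ∃ A : Set P, A.Finite ∧ ∀ (J : Type) [Finite J] (a : J → OddMap G H),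
      IsAlmostMul ε a → (∀ j, ∀ c ∈ A, (a j).eval (e c) = f c) →
      ∀ (v : α → P) (xs : Fin k → P), Holds (MonoidHom.id P) φ v xs →
      DensityLE δ {j | ¬ Holds f φ (fun b => (a j).eval (e (v b)))
        fun b => (a j).eval (e (xs b))} := by
  induction hφ generalizing δ with
  | falsum =>
    exact ⟨1, one_pos, ∅, Set.finite_empty, fun J _ a _ _ v xs hv =>
      (holds_falsum _ _ _ hv).elim⟩
  | equal t₁ t₂ =>
    obtain ⟨ε₀, hε₀, A₀, hA₀, h0⟩ := exists_termVal_eval e f t₁ (δ / 2) (by positivity)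
    obtain ⟨ε₁, hε₁, A₁, hA₁, h1⟩ := exists_termVal_eval e f t₂ (δ / 2) (by positivity)
    refine ⟨min ε₀ ε₁, by positivity, A₀ ∪ A₁, hA₀.union hA₁, fun J _ a ha hc v xs hv => ?_⟩
    refine ((h0 J a (ha.mono (min_le_left _ _)) (fun j c h => hc j c (Or.inl h))
      (Sum.elim v xs)).union (h1 J a (ha.mono (min_le_right _ _))
        (fun j c h => hc j c (Or.inr h)) (Sum.elim v xs))).mono ?_ (by linarith)
    intro j hj
    by_contra hcon
    simp only [Set.mem_union, Set.mem_ofPred_eq, not_or, not_not, ne_eq] at hcon hj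
    rw [holds_equal] at hv hj
    have hel : Sum.elim (fun b => (a j).eval (e (v b))) (fun b => (a j).eval (e (xs b))) =
        fun b => (a j).eval (e (Sum.elim v xs b)) := by
      ext (b | b) <;> rfl
    rw [hel, ← hcon.1, ← hcon.2, hv] at hj
    exact hj rfl
  | rel R ts => exact (isEmpty_relations P _).elim R
  | inf _ _ ih₁ ih₂ =>
    obtain ⟨ε₀, hε₀, A₀, hA₀, h0⟩ := ih₁ (δ / 2) (by positivity)
    obtain ⟨ε₁, hε₁, A₁, hA₁, h1⟩ := ih₂ (δ / 2) (by positivity)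
    refine ⟨min ε₀ ε₁, by positivity, A₀ ∪ A₁, hA₀.union hA₁, fun J _ a ha hc v xs hv => ?_⟩
    rw [holds_inf] at hv
    refine ((h0 J a (ha.mono (min_le_left _ _)) (fun j c h => hc j c (Or.inl h)) v xs hv.1).union
      (h1 J a (ha.mono (min_le_right _ _)) (fun j c h => hc j c (Or.inr h)) v xs hv.2)).mono ?_
      (by linarith)
    intro j hj
    by_contra hcon
    simp only [Set.mem_union, Set.mem_ofPred_eq, not_or, not_not, holds_inf] at hcon hj
    exact hj hcon
  | sup _ _ ih₁ ih₂ =>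
    obtain ⟨ε₀, hε₀, A₀, hA₀, h0⟩ := ih₁ δ hδ
    obtain ⟨ε₁, hε₁, A₁, hA₁, h1⟩ := ih₂ δ hδ
    refine ⟨min ε₀ ε₁, by positivity, A₀ ∪ A₁, hA₀.union hA₁, fun J _ a ha hc v xs hv => ?_⟩
    rw [holds_sup] at hv
    rcases hv with hv | hv
    · refine (h0 J a (ha.mono (min_le_left _ _)) (fun j c h => hc j c (Or.inl h)) v xs hv).mono
        (fun j hj h => hj ?_) le_rfl
      exact (holds_sup _ _ _ _ _).2 (Or.inl h)
    · refine (h1 J a (ha.mono (min_le_right _ _)) (fun j c h => hc j c (Or.inr h)) v xs hv).mono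
        (fun j hj h => hj ?_) le_rfl
      exact (holds_sup _ _ _ _ _).2 (Or.inr h)
  | @all k φ _ ih =>
    obtain ⟨ε₀, hε₀, A₀, hA₀, h0⟩ := ih δ hδ
    -- The other half of `ε₀` pays for the extension below.
    refine ⟨ε₀ / 2, by positivity, A₀, hA₀, fun J _ a ha hc v xs hv => ?_⟩
    rw [holds_all] at hv
    -- Each bad member gets a counterexample; the value `1` at good members is arbitrary.
    have hb : ∀ j, ∃ b : H, ¬ Holds f φ.all (fun b => (a j).eval (e (v b)))
        (fun b => (a j).eval (e (xs b))) → ¬ Holds f φ (fun b => (a j).eval (e (v b)))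
          (Fin.snoc (fun b => (a j).eval (e (xs b))) b) := by
      intro j
      by_cases h : Holds f φ.all (fun b => (a j).eval (e (v b)))
        (fun b => (a j).eval (e (xs b)))
      · exact ⟨1, fun h' => (h' h).elim⟩
      · rw [holds_all, not_forall] at h
        obtain ⟨b, hb⟩ := h
        exact ⟨b, fun _ => hb⟩
    choose b hb using hb
    obtain ⟨N, hN, x, a', ha', hA', hx⟩ := ha.exists_extension hi ht hs (half_pos hε₀)
      (e '' (A₀ ∪ Set.range v ∪ Set.range xs))
      (((hA₀.union (Set.finite_range v)).union (Set.finite_range xs)).image e) b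
    have hkeep : ∀ p, ∀ g ∈ A₀ ∪ Set.range v ∪ Set.range xs,
        (a' p).eval (e g) = (a p.1).eval (e g) :=
      fun p g hg => hA' p _ ⟨g, hg, rfl⟩
    -- One element `x` now evaluates to all these counterexamples, while the formula does hold at it
    -- in the source. Every copy of a bad member is therefore bad for the instance, and copying
    -- preserves density.
    have key := h0 (J × Fin N) a' (ha'.mono (by linarith))
      (fun p c h => (hkeep p c (Or.inl (Or.inl h))).trans (hc _ _ h)) v _ (hv (e.symm x))
    refine DensityLE.of_fst_preimage hN (key.mono (fun p hp => ?_) le_rfl)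
    have h1 : (fun b => (a' p).eval (e (v b))) = fun b => (a p.1).eval (e (v b)) :=
      funext fun b => hkeep p _ (Or.inl (Or.inr ⟨b, rfl⟩))
    have h2 : (fun b => (a' p).eval (e (Fin.snoc (α := fun _ => P) xs (e.symm x) b))) =
        Fin.snoc (α := fun _ => H) (fun b => (a p.1).eval (e (xs b))) (b p.1) := by
      ext i
      refine Fin.lastCases ?_ (fun i => ?_) i
      · simp [hx]
      · simpa using hkeep p _ (Or.inr ⟨i, rfl⟩)
    change ¬ Holds f φ _ _
    rw [h1, h2]
    exact hb p.1 hp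
  | @ex k φ _ ih =>
    obtain ⟨ε₀, hε₀, A₀, hA₀, h0⟩ := ih δ hδ
    refine ⟨ε₀, hε₀, A₀, hA₀, fun J _ a ha hc v xs hv => ?_⟩
    rw [holds_ex] at hv
    obtain ⟨x, hx⟩ := hv
    refine (h0 J a ha hc v _ hx).mono (fun j hj h => hj ?_) le_rfl
    rw [holds_ex]
    refine ⟨(a j).eval (e x), ?_⟩
    convert h using 1
    ext i
    refine Fin.lastCases ?_ (fun i => ?_) i <;> simp

end Transfer

/-! ### Prescribed values and the main theorem -/

/-- Almost multiplicative families with prescribed values at suitable new elements. -/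
lemma OddMap.exists_isAlmostMul_eval_eq {ι : Type*} {G : ι → Type*} [∀ i, Group (G i)]
    {H : Type*} [Group H] (f : CoprodI G →* H) {i₀ i₁ : ι} (hi : i₀ ≠ i₁)
    {t : G i₀} (ht : Function.Injective fun n : ℤ => t ^ n) {s : G i₁} (hs : s ≠ 1)
    {m : ℕ} (b : Fin m → H) {ε : ℝ} (hε : 0 < ε) (A : Set (CoprodI G)) (hA : A.Finite) :
    ∃ J : Type, Finite J ∧ Nonempty J ∧ ∃ a : J → OddMap G H, IsAlmostMul ε a ∧
      (∀ j, ∀ g ∈ A, (a j).eval g = f g) ∧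
      ∃ x : Fin m → CoprodI G, ∀ j i, (a j).eval (x i) = b i := by
  induction m generalizing ε A with
  | zero =>
    refine ⟨Unit, inferInstance, inferInstance, fun _ => ofHom f, fun i u v => ?_,
      fun _ g _ => eval_ofHom f g, Fin.elim0, fun _ i => i.elim0⟩
    simpa [ofHom] using DensityLE.empty hε.le
  | succ m ih =>
    obtain ⟨J, hJ, hJ', a, ha, haf, x, hx⟩ :=
      ih (fun i => b i.castSucc) (half_pos hε) A hA
    obtain ⟨N, hN, y, a', ha', hA', hy⟩ := ha.exists_extension hi ht hs (half_pos hε)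
      (A ∪ Set.range x) (hA.union (Set.finite_range x)) fun _ => b (Fin.last m)
    have : Nonempty (Fin N) := ⟨⟨0, hN⟩⟩
    refine ⟨J × Fin N, inferInstance, inferInstance, a', ha'.mono (by linarith),
      fun p g hg => (hA' p g (Or.inl hg)).trans (haf _ _ hg),
      Fin.snoc (α := fun _ => CoprodI G) x y, fun p i => ?_⟩
    refine Fin.lastCases ?_ (fun i => ?_) i
    · simpa using hy p
    · simpa using (hA' p (x i) (Or.inr ⟨i, rfl⟩)).trans (hx _ _)

lemma zpow_of_injective {α : Type*} (a : α) :
    Function.Injective fun n : ℤ => FreeGroup.of a ^ n := by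
  intro k l h
  have := congrArg (FreeGroup.lift fun _ => Multiplicative.ofAdd (1 : ℤ)) h
  simpa [← ofAdd_zsmul] using this

/-- A positive formula is true everywhere if it is true at a translate of the new basis elements. -/
lemma IsPositive.solutionSet_eq_univ {n m : ℕ} {φ : FormulaOver n m} (hφ : IsPositive φ)
    (g : Fin m → FreeGroup (Fin n))
    (h : SatisfiedBy (freeInclusion n m) φ
      fun i => (freeInclusion n m (g i))⁻¹ * newBasis n m i) :
    solutionSet φ = Set.univ := by
  refine Set.eq_univ_of_forall fun u => ?_
  -- A retraction onto `F_n` chosen so that `g i⁻¹ * e_{n+i}` goes to `u i`.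
  let r : FreeGroup (Fin (n + m)) →* FreeGroup (Fin n) :=
    FreeGroup.lift (Fin.addCases FreeGroup.of fun i => g i * u i)
  have hr : r.comp (freeInclusion n m) = MonoidHom.id _ := by
    ext i
    simp [r, freeInclusion]
  have hr' : ∀ x, r (freeInclusion n m x) = x := fun x => DFunLike.congr_fun hr x
  have hsurj : Function.Surjective r := fun x => ⟨_, hr' x⟩
  have key := IsPositive.holds_of_surjective hsurj (freeInclusion n m) hφ _ _
    ((satisfiedBy_iff_holds _ _ _ Fin.elim0).1 h)
  rw [hr] at key
  have hu : r ∘ (fun i => (freeInclusion n m (g i))⁻¹ * newBasis n m i) = u := by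
    ext i
    have h1 : r (newBasis n m i) = g i * u i := by simp [r, newBasis]
    simp [hr', h1]
  rw [hu] at key
  exact (satisfiedBy_iff_holds _ _ _ _).2 key

theorem mainTheorem3 (n m : ℕ) (φ : FormulaOver n m) (hφ : IsPositive φ) :
    (SatisfiedBy (freeInclusion n m) φ (newBasis n m) → solutionSet φ = Set.univ) ∧
    (2 ≤ n → solutionSet φ ≠ Set.univ → ¬ IsGenericFormula φ) := by
  refine ⟨fun h => hφ.solutionSet_eq_univ 1 (by simpa using h), ?_⟩
  rintro hn hne ⟨S, hS⟩
  refine hne ?_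
  let e := freeGroupEquivCoprodI (ι := Fin n)
  let f := freeInclusion n m
  -- Two distinct free factors exist because `2 ≤ n`.
  have hi : (⟨0, by omega⟩ : Fin n) ≠ ⟨1, by omega⟩ := by simp
  have ht := zpow_of_injective ()
  have hs : FreeGroup.of () ≠ 1 := FreeGroup.of_ne_one ()
  obtain ⟨ε₀, hε₀, A₀, hA₀, h0⟩ := IsPositive.exists_holds_eval e f hi ht hs hφ (1 / 3)
    (by norm_num)
  have hm : (0 : ℝ) < 1 / (3 * (m + 1)) := by positivity
  -- The translating element is known only after `x` is built, so the family must respect the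
  -- coordinates of all candidates.
  let A₁ : Set (FreeGroup (Fin n)) := ⋃ g ∈ S, Set.range fun i : Fin m => (g i)⁻¹
  have hA₁ : A₁.Finite := S.finite_toSet.biUnion fun g _ => Set.finite_range _
  obtain ⟨J, hJ, hJ', a, ha, haf, x, hx⟩ := OddMap.exists_isAlmostMul_eval_eq
    (f.comp e.symm.toMonoidHom) hi ht hs (newBasis n m) (lt_min hε₀ hm) (e '' (A₀ ∪ A₁))
    ((hA₀.union hA₁).image e)
  have haf' : ∀ j, ∀ g ∈ A₀ ∪ A₁, (a j).eval (e g) = f g := fun j g hg => by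
    simpa using haf j _ ⟨g, hg, rfl⟩
  have hmem : (fun i => e.symm (x i)) ∈ ⋃ g ∈ S, g • solutionSet φ := hS ▸ Set.mem_univ _
  obtain ⟨g, hg, hgx⟩ := Set.mem_iUnion₂.1 hmem
  rw [Set.mem_smul_set_iff_inv_smul_mem] at hgx
  have h1 := h0 J a (ha.mono (min_le_left _ _)) (fun j c hc => haf' j c (Or.inl hc)) _ Fin.elim0
    ((satisfiedBy_iff_holds _ _ _ _).1 hgx)
  have h2 := DensityLE.iUnion_fin fun i : Fin m =>
    (ha.mono (min_le_right _ _)).eval hm.le (e (g i)⁻¹) (x i)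
  -- The formula fails on density at most 1/3 and the m products `g i⁻¹ * x i` together on at most
  -- m/(3(m+1)) ≤ 1/3, so some member is good for everything.
  obtain ⟨j, hj⟩ := (h1.union h2).exists_notMem (by
    have : (m : ℝ) * (1 / (3 * (m + 1))) ≤ 1 / 3 := by
      rw [mul_one_div, div_le_div_iff₀ (by positivity) (by norm_num)]
      linarith
    linarith)
  simp only [Set.mem_union, Set.mem_iUnion, Set.mem_ofPred_eq, not_or, not_not, not_exists,
    ne_eq] at hj
  refine hφ.solutionSet_eq_univ g ?_
  rw [satisfiedBy_iff_holds _ _ _ fun b => (a j).eval (e (Fin.elim0 b))]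
  convert hj.1 using 1
  · ext1 i
    have h3 : (a j).eval (e (g i)⁻¹) = (f (g i))⁻¹ := by
      rw [haf' j _ (Or.inr (Set.mem_biUnion hg ⟨i, rfl⟩)), map_inv]
    have h4 := hj.2 i
    rw [h3, hx] at h4
    rw [← h4]
    simp
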